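/- Let $1\le k\le n$ be integers, let $\sigma>0$, and let $\Theta_k^{\uparrow}\subset\mathbb{R}^n$ be the set of nondecreasing vectors with at most $k$ constant pieces, i.e. of all $\theta\in\mathbb{R}^n$ for which there are integers $0=a_0\le a_1\le\cdots\le a_k=n$ and reals $\mu_1\le\cdots\le\mu_k$ such that $\theta_i=\mu_j$ for all integers $i$ with $a_{j-1}<i\le a_j$. For $X\in\mathbb{R}^n$ let $$\widehat\theta^{(iso)}=\widehat\theta^{(iso)}(X)=\mathop{\rm argmin}_{\theta_1\le\theta_2\le\cdots\le\theta_n}\|X-\theta\|^2$$ be the ordinary isotonic regression estimator, where $\|\cdot\|$ is the Euclidean norm. There exists a universal constant $c>0$ (independent of $n$, $k$ and $\sigma$) such that, for all such $n$, $k$ and $\sigma$, $$\sup_{\theta^*\in\Theta_k^{\uparrow}}\mathbb{E}\big\|\widehat\theta^{(iso)}-\theta^*\big\|^2\ \ge\ c\,\sigma^2k\log(en/k),$$ where the expectation is taken under $X\sim N(\theta^*,\sigma^2I_n)$. -/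

import Mathlib

open MeasureTheory ProbabilityTheory
open scoped ENNReal

/-- The class `Θ_k^↑` of nondecreasing vectors in `ℝⁿ` with at most `k` constant pieces: there are
integers `0 = a₀ ≤ a₁ ≤ ⋯ ≤ a_k = n` and reals `μ₁ ≤ ⋯ ≤ μ_k` such that `θ_i = μ_j` whenever
`a_{j-1} < i ≤ a_j`.  The coordinate with 1-based index `i + 1` is `θ i` for `i : Fin n`. -/
def isotonicPieces (n k : ℕ) : Set (EuclideanSpace ℝ (Fin n)) :=
  {θ | ∃ (a : Fin (k + 1) → ℕ) (μ : Fin k → ℝ),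
    a 0 = 0 ∧ Monotone a ∧ a (Fin.last k) = n ∧ Monotone μ ∧
      ∀ (j : Fin k) (i : Fin n),
        a j.castSucc < (i : ℕ) + 1 → (i : ℕ) + 1 ≤ a j.succ → θ i = μ j}

/-- The cone of nondecreasing vectors `θ₁ ≤ θ₂ ≤ ⋯ ≤ θ_n`. -/
def isotonicCone (n : ℕ) : Set (EuclideanSpace ℝ (Fin n)) :=
  {θ | Monotone fun i : Fin n => θ i}

/-- The least squares problem over the nondecreasing vectors has exactly one solution. -/
theorem existsUnique_isotonicLSE (n : ℕ) (x : EuclideanSpace ℝ (Fin n)) :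
    ∃! v, v ∈ isotonicCone n ∧ ∀ w ∈ isotonicCone n, ‖x - v‖ ^ 2 ≤ ‖x - w‖ ^ 2 := by
  have hne : (isotonicCone n).Nonempty := ⟨0, fun i j _ => by simp⟩
  have hconv : Convex ℝ (isotonicCone n) := by
    intro u hu v hv s t hs ht _ i j hij
    simp only [PiLp.add_apply, PiLp.smul_apply, smul_eq_mul]
    exact add_le_add (mul_le_mul_of_nonneg_left (hu hij) hs)
      (mul_le_mul_of_nonneg_left (hv hij) ht)
  have hclosed : IsClosed (isotonicCone n) := by
    have : isotonicCone n = ⋂ (i : Fin n) (j : Fin n) (_ : i ≤ j),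
        {θ : EuclideanSpace ℝ (Fin n) | θ i ≤ θ j} := by
      ext θ
      simp only [isotonicCone, Set.mem_setOf_eq, Set.mem_iInter]
      exact ⟨fun h i j hij => h hij, fun h i j hij => h i j hij⟩
    rw [this]
    exact isClosed_iInter fun i => isClosed_iInter fun j => isClosed_iInter fun _ =>
      isClosed_le (by fun_prop) (by fun_prop)
  obtain ⟨v, hv, hmin⟩ := exists_norm_eq_iInf_of_complete_convex hne hclosed.isComplete hconv x
  have hle : ∀ w ∈ isotonicCone n, ‖x - v‖ ≤ ‖x - w‖ := fun w hw => by
    rw [hmin]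
    exact ciInf_le ⟨0, Set.forall_mem_range.2 fun _ => norm_nonneg _⟩
      (⟨w, hw⟩ : isotonicCone n)
  have hinner := (norm_eq_iInf_iff_real_inner_le_zero hconv hv).1 hmin
  refine ⟨v, ⟨hv, fun w hw => pow_le_pow_left₀ (norm_nonneg _) (hle w hw) 2⟩, ?_⟩
  rintro u ⟨hu, hu'⟩
  have h1 := hu' v hv
  have h2 := hinner u hu
  have h3 : ‖x - u‖ ^ 2 = ‖x - v‖ ^ 2 - 2 * inner ℝ (x - v) (u - v) + ‖u - v‖ ^ 2 := by
    rw [← norm_sub_sq_real]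
    congr 2
    abel
  have h4 : ‖u - v‖ ^ 2 = 0 := le_antisymm (by linarith) (sq_nonneg _)
  exact sub_eq_zero.1 (norm_eq_zero.1 (pow_eq_zero_iff two_ne_zero |>.1 h4))

/-- The ordinary isotonic regression estimator: the minimizer of `‖x - θ‖²` over all
nondecreasing `θ`. -/
noncomputable def isotonicLSE (n : ℕ) (x : EuclideanSpace ℝ (Fin n)) :
    EuclideanSpace ℝ (Fin n) :=
  (existsUnique_isotonicLSE n x).choose

/-- The risk `E ‖θ̂(X) - θ‖²` of the isotonic regression estimator, for `X ∼ N(θ, σ² I_n)`,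
as a number in `[0, ∞]`. -/
noncomputable def isotonicRisk (n : ℕ) (σ : ℝ) (θ : EuclideanSpace ℝ (Fin n)) : ℝ≥0∞ :=
  ∫⁻ x, ENNReal.ofReal (‖isotonicLSE n x - θ‖ ^ 2)
    ∂(multivariateGaussian θ (σ ^ 2 • (1 : Matrix (Fin n) (Fin n) ℝ)))

/-! Write `x = θ + σ • z` and let `v` be the estimate. If `v + u` is still monotone, the variational
inequality gives `⟪x - v, u⟫ ≤ 0`, hence `2⟪x - θ, u⟫ - ‖u‖² ≤ ‖v - θ‖²`
(`le_norm_isotonicLSE_sub_sq`). So every admissible `u`, even one depending on the noise, bounds the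
loss from below.

Give `θ` jumps so large that `v` keeps them; then `u` need only be nondecreasing within each of the
`k` pieces. Cut each piece into dyadic blocks of size `2 ^ l`, and on a block with noise sum `S` let
`u` be `σ t / √(2 ^ l)` times `-5` if `S ≥ 0` and `-7` otherwise. As `7 / 5 < √2`, `u` is monotone
whatever the signs (`blockValue_le_blockValue`). The factors are `-6 ± 1`: the `-6` contributes mean
zero, while `E|S|` is of order `√(2 ^ l)`, so each block gains a constant times `σ²` on average
(`integral_blockGain`). There are of order `k log(en/k)` blocks. Fixed jumps beat only bounded
noise, so the expectation is first truncated to a large ball. -/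

/-! ### Projection onto the monotone cone. -/

theorem convex_isotonicCone (n : ℕ) : Convex ℝ (isotonicCone n) := by
  intro u hu v hv s t hs ht _ i j hij
  simp only [PiLp.add_apply, PiLp.smul_apply, smul_eq_mul]
  exact add_le_add (mul_le_mul_of_nonneg_left (hu hij) hs)
    (mul_le_mul_of_nonneg_left (hv hij) ht)

theorem isotonicLSE_mem (n : ℕ) (x : EuclideanSpace ℝ (Fin n)) :
    isotonicLSE n x ∈ isotonicCone n :=
  (existsUnique_isotonicLSE n x).choose_spec.1.1

theorem norm_sub_isotonicLSE_le {n : ℕ} (x : EuclideanSpace ℝ (Fin n))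
    {w : EuclideanSpace ℝ (Fin n)} (hw : w ∈ isotonicCone n) :
    ‖x - isotonicLSE n x‖ ≤ ‖x - w‖ :=
  le_of_sq_le_sq ((existsUnique_isotonicLSE n x).choose_spec.1.2 w hw) (norm_nonneg _)

/-- The variational inequality for the projection onto the monotone cone. -/
theorem inner_sub_isotonicLSE_nonpos {n : ℕ} (x : EuclideanSpace ℝ (Fin n))
    {w : EuclideanSpace ℝ (Fin n)} (hw : w ∈ isotonicCone n) :
    inner ℝ (x - isotonicLSE n x) (w - isotonicLSE n x) ≤ 0 := by
  have hv := isotonicLSE_mem n x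
  refine (norm_eq_iInf_iff_real_inner_le_zero (convex_isotonicCone n) hv).1 ?_ w hw
  have : Nonempty (isotonicCone n) := ⟨⟨_, hv⟩⟩
  refine le_antisymm (le_ciInf fun w => norm_sub_isotonicLSE_le x w.2) ?_
  exact ciInf_le (f := fun w : isotonicCone n => ‖x - w‖)
    ⟨0, Set.forall_mem_range.2 fun _ => norm_nonneg _⟩ ⟨_, hv⟩

/-- Cauchy–Schwarz in the variational inequality at `θ`. This is what makes large jumps of the mean
survive in the estimate. -/
theorem norm_isotonicLSE_sub_le {n : ℕ} (x : EuclideanSpace ℝ (Fin n))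
    {θ : EuclideanSpace ℝ (Fin n)} (hθ : θ ∈ isotonicCone n) :
    ‖isotonicLSE n x - θ‖ ≤ ‖x - θ‖ := by
  have h := inner_sub_isotonicLSE_nonpos x hθ
  set v := isotonicLSE n x
  have e : x - v = (x - θ) - (v - θ) := by abel
  have e2 : θ - v = -(v - θ) := by abel
  rw [e, e2, inner_neg_right, inner_sub_left, real_inner_self_eq_norm_sq] at h
  have h2 := real_inner_le_norm (x - θ) (v - θ)
  by_contra! hlt
  nlinarith [norm_nonneg (x - θ), norm_nonneg (v - θ)]

/-- If the estimator stays monotone after adding `u`, then `u` certifies a lower bound on the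
loss. -/
theorem le_norm_isotonicLSE_sub_sq {n : ℕ} (x θ u : EuclideanSpace ℝ (Fin n))
    (hu : isotonicLSE n x + u ∈ isotonicCone n) :
    2 * inner ℝ (x - θ) u - ‖u‖ ^ 2 ≤ ‖isotonicLSE n x - θ‖ ^ 2 := by
  have h := inner_sub_isotonicLSE_nonpos x hu
  set v := isotonicLSE n x
  have e : x - v = (x - θ) - (v - θ) := by abel
  rw [add_sub_cancel_left, e, inner_sub_left] at h
  have h3 := norm_sub_sq_real (v - θ) u
  nlinarith [sq_nonneg ‖(v - θ) - u‖]

/-! ### Test vectors on dyadic blocks. -/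

section Blocks

variable {n : ℕ} (p q : Fin n → ℕ)

/-- The indices in piece `j` at level `l`. -/
def levelBlock (j l : ℕ) : Finset (Fin n) :=
  Finset.univ.filter fun i => p i = j ∧ q i = l

/-- The sum of the noise over a block. -/
def blockSum (j l : ℕ) (z : EuclideanSpace ℝ (Fin n)) : ℝ :=
  ∑ i ∈ levelBlock p q j l, z i

/-- The value of the test vector on a block at level `l` with noise sum `s`. -/
noncomputable def blockValue (t : ℝ) (l : ℕ) (s : ℝ) : ℝ :=
  -(t / √(2 ^ l) * if 0 ≤ s then 5 else 7)

/-- The piecewise constant test vector that follows the sign of the noise on each block. -/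
noncomputable def testVector (L : ℕ) (t : ℝ) (z : EuclideanSpace ℝ (Fin n)) :
    EuclideanSpace ℝ (Fin n) :=
  WithLp.toLp 2 fun i =>
    if q i < L then blockValue t (q i) (blockSum p q (p i) (q i) z) else 0

/-- The lower bound on `2 ⟪z, u⟫ - ‖u‖²` obtained from the test vector. -/
noncomputable def blockGain (k L : ℕ) (t : ℝ) (z : EuclideanSpace ℝ (Fin n)) : ℝ :=
  ∑ b ∈ Finset.range k ×ˢ Finset.range L,
    (2 * (t / √(2 ^ b.2)) * (|blockSum p q b.1 b.2 z| - 6 * blockSum p q b.1 b.2 z) - 49 * t ^ 2)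

variable {p q}

theorem blockValue_nonpos {t : ℝ} (ht : 0 ≤ t) (l : ℕ) (s : ℝ) : blockValue t l s ≤ 0 := by
  unfold blockValue
  have : 0 ≤ t / √(2 ^ l) := by positivity
  split_ifs <;> linarith

theorem le_blockValue {t : ℝ} (ht : 0 ≤ t) (l : ℕ) (s : ℝ) :
    -(7 * (t / √(2 ^ l))) ≤ blockValue t l s := by
  unfold blockValue
  have : 0 ≤ t / √(2 ^ l) := by positivity
  split_ifs <;> linarith

theorem blockValue_le {t : ℝ} (ht : 0 ≤ t) (l : ℕ) (s : ℝ) :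
    blockValue t l s ≤ -(5 * (t / √(2 ^ l))) := by
  unfold blockValue
  have : 0 ≤ t / √(2 ^ l) := by positivity
  split_ifs <;> linarith

/-- The reason for 5 and 7: passing to a higher level shrinks the scale by at least `√2 > 7 / 5`, so
the signs cannot break monotonicity. -/
theorem blockValue_le_blockValue {t : ℝ} (ht : 0 ≤ t) {l l' : ℕ} (h : l < l') (s s' : ℝ) :
    blockValue t l s ≤ blockValue t l' s' := by
  refine (blockValue_le ht l s).trans (le_trans ?_ (le_blockValue ht l' s'))
  have hs : 7 * √(2 ^ l) ≤ 5 * √(2 ^ l') := by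
    have e1 : (7 : ℝ) * √(2 ^ l) = √(49 * 2 ^ l) := by
      rw [Real.sqrt_mul (by norm_num), show (49 : ℝ) = 7 ^ 2 by norm_num,
        Real.sqrt_sq (by norm_num)]
    have e2 : (5 : ℝ) * √(2 ^ l') = √(25 * 2 ^ l') := by
      rw [Real.sqrt_mul (by norm_num), show (25 : ℝ) = 5 ^ 2 by norm_num,
        Real.sqrt_sq (by norm_num)]
    rw [e1, e2]
    apply Real.sqrt_le_sqrt
    have : (2 : ℝ) ^ (l + 1) ≤ 2 ^ l' := pow_le_pow_right₀ (by norm_num) h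
    rw [pow_succ] at this
    have : (0 : ℝ) < 2 ^ l := by positivity
    linarith
  have h1 : 0 < √((2 : ℝ) ^ l) := by positivity
  have h2 : 0 < √((2 : ℝ) ^ l') := by positivity
  have : 7 * (t / √(2 ^ l')) ≤ 5 * (t / √(2 ^ l)) := by
    rw [← mul_div_assoc, ← mul_div_assoc, div_le_div_iff₀ h2 h1]
    nlinarith
  linarith

theorem testVector_nonpos {L : ℕ} {t : ℝ} (ht : 0 ≤ t) (z : EuclideanSpace ℝ (Fin n))
    (i : Fin n) : testVector p q L t z i ≤ 0 := by
  simp only [testVector]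
  split_ifs
  · exact blockValue_nonpos ht _ _
  · exact le_rfl

theorem le_testVector {L : ℕ} {t : ℝ} (ht : 0 ≤ t) (z : EuclideanSpace ℝ (Fin n))
    (i : Fin n) : -(7 * t) ≤ testVector p q L t z i := by
  simp only [testVector]
  split_ifs
  · refine le_trans ?_ (le_blockValue ht _ _)
    have : t / √(2 ^ q i) ≤ t :=
      div_le_self ht (Real.one_le_sqrt.2 (one_le_pow₀ (by norm_num)))
    linarith
  · linarith

theorem testVector_mono {L : ℕ} {t : ℝ} (ht : 0 ≤ t) (z : EuclideanSpace ℝ (Fin n))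
    {i i' : Fin n} (hp : p i = p i') (hq : q i ≤ q i') :
    testVector p q L t z i ≤ testVector p q L t z i' := by
  rcases hq.lt_or_eq with h | h
  · by_cases hL : q i' < L
    · simp only [testVector, hL, h.trans hL, if_true]
      exact blockValue_le_blockValue ht h _ _
    · refine (testVector_nonpos ht z i).trans_eq ?_
      simp [testVector, hL]
  · simp [testVector, hp, h]

/-- The linear part is exact; the only loss is bounding the squared factor, 25 or 49, by 49. -/
theorem blockGain_le {k L : ℕ} {t : ℝ} (hpk : ∀ i, p i < k)
    (hcard : ∀ j < k, ∀ l < L, (levelBlock p q j l).card = 2 ^ l)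
    (z : EuclideanSpace ℝ (Fin n)) :
    blockGain p q k L t z ≤
      2 * inner ℝ z (testVector p q L t z) - ‖testVector p q L t z‖ ^ 2 := by
  set u := testVector p q L t z with hu
  have e : 2 * inner ℝ z u - ‖u‖ ^ 2 = ∑ i, (2 * (z i * u i) - u i ^ 2) := by
    rw [EuclideanSpace.real_norm_sq_eq, PiLp.inner_apply, Finset.mul_sum,
      ← Finset.sum_sub_distrib]
    simp [mul_comm]
  have e2 : ∑ i, (2 * (z i * u i) - u i ^ 2) =
      ∑ i with q i < L, (2 * (z i * u i) - u i ^ 2) := by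
    rw [Finset.sum_filter]
    refine Finset.sum_congr rfl fun i _ => ?_
    split_ifs with h
    · rfl
    · simp [hu, testVector, h]
  rw [e, e2, ← Finset.sum_fiberwise_of_maps_to (t := Finset.range k ×ˢ Finset.range L)
    (g := fun i => (p i, q i)) (by simp +contextual [hpk])]
  unfold blockGain
  refine Finset.sum_le_sum ?_
  rintro ⟨j, l⟩ hb
  simp only [Finset.mem_product, Finset.mem_range] at hb
  have hblock : ((Finset.univ.filter fun i => q i < L).filter fun i => (p i, q i) = (j, l)) =
      levelBlock p q j l := by
    ext i
    simp only [levelBlock, Finset.mem_filter, Finset.mem_univ, true_and, Prod.mk.injEq]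
    constructor
    · exact fun h => h.2
    · exact fun h => ⟨h.2 ▸ hb.2, h⟩
  set c := blockValue t l (blockSum p q j l z) with hc
  have hsum : ∑ i ∈ levelBlock p q j l, (2 * (z i * u i) - u i ^ 2) =
      2 * c * blockSum p q j l z - 2 ^ l * c ^ 2 := by
    have : ∀ i ∈ levelBlock p q j l, 2 * (z i * u i) - u i ^ 2 = 2 * c * z i - c ^ 2 := by
      intro i hi
      simp only [levelBlock, Finset.mem_filter, Finset.mem_univ, true_and] at hi
      have : u i = c := by simp [hu, testVector, hi.1, hi.2, hb.2, hc]
      rw [this]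
      ring
    rw [Finset.sum_congr rfl this, Finset.sum_sub_distrib, ← Finset.mul_sum, Finset.sum_const,
      hcard j hb.1 l hb.2, blockSum]
    simp
  rw [hblock, hsum]
  have hr : (2 : ℝ) ^ l * (t / √(2 ^ l)) ^ 2 = t ^ 2 := by
    rw [div_pow, Real.sq_sqrt (by positivity)]
    field_simp
  rw [hc, blockValue]
  set r := t / √(2 ^ l)
  set T := blockSum p q j l z
  split_ifs with hT
  · rw [abs_of_nonneg hT]
    nlinarith [sq_nonneg t]
  · rw [abs_of_neg (not_le.1 hT)]
    nlinarith [sq_nonneg t]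

/-- Around a mean with large jumps between the pieces, the loss is at least the block gain. -/
theorem blockGain_le_norm_isotonicLSE_sub_sq {k L : ℕ} {t σ G : ℝ} (ht : 0 ≤ t) (hσ : 0 ≤ σ)
    (hG : 0 ≤ G) (hpk : ∀ i, p i < k) (hp : Monotone p)
    (hq : ∀ i i', i ≤ i' → p i = p i' → q i ≤ q i')
    (hcard : ∀ j < k, ∀ l < L, (levelBlock p q j l).card = 2 ^ l)
    (θ z : EuclideanSpace ℝ (Fin n)) (hθ : ∀ i, θ i = G * p i)
    (hz : 2 * (σ * ‖z‖) + 7 * (σ * t) ≤ G) :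
    σ ^ 2 * blockGain p q k L t z ≤ ‖isotonicLSE n (θ + σ • z) - θ‖ ^ 2 := by
  have hcone : θ ∈ isotonicCone n := fun i j hij => by
    simp only [hθ]
    exact mul_le_mul_of_nonneg_left (by exact_mod_cast hp hij) hG
  set v := isotonicLSE n (θ + σ • z)
  have hv : v ∈ isotonicCone n := isotonicLSE_mem _ _
  have hd : ‖v - θ‖ ≤ σ * ‖z‖ := by
    have := norm_isotonicLSE_sub_le (θ + σ • z) hcone
    rwa [add_sub_cancel_left, norm_smul, Real.norm_of_nonneg hσ] at this
  have hdi : ∀ i, |v i - θ i| ≤ σ * ‖z‖ := fun i =>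
    (PiLp.norm_apply_le (v - θ) i).trans hd
  have hmem : v + σ • testVector p q L t z ∈ isotonicCone n := by
    intro i i' hii
    simp only [PiLp.add_apply, PiLp.smul_apply, smul_eq_mul]
    rcases (hp hii).lt_or_eq with h | h
    -- Across a jump the mean rises by at least `G`, while the estimation error costs at most `2 *
    -- (σ * ‖z‖)` and the test vector at most `7 * (σ * t)`.
    · have h1 := abs_le.1 (hdi i)
      have h2 := abs_le.1 (hdi i')
      have h3 : G * (p i + 1) ≤ G * p i' :=
        mul_le_mul_of_nonneg_left (by exact_mod_cast h) hG
      have h4 := mul_le_mul_of_nonneg_left (testVector_nonpos (p := p) (q := q) (L := L) ht z i) hσ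
      have h5 := mul_le_mul_of_nonneg_left (le_testVector (p := p) (q := q) (L := L) ht z i') hσ
      rw [hθ] at h1 h2
      linarith [h1.2, h2.1]
    · exact add_le_add (hv hii)
        (mul_le_mul_of_nonneg_left (testVector_mono ht z h (hq i i' hii h)) hσ)
  refine le_trans ?_ (le_norm_isotonicLSE_sub_sq _ θ _ hmem)
  rw [add_sub_cancel_left, real_inner_smul_left, real_inner_smul_right, norm_smul, mul_pow,
    Real.norm_of_nonneg hσ]
  linarith [mul_le_mul_of_nonneg_left (blockGain_le (t := t) hpk hcard z) (sq_nonneg σ)]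

end Blocks

/-! ### Equal pieces and their dyadic levels. -/

section Levels

/-- The piece containing an index, for `k` pieces of length `m`, the last one possibly longer. -/
def pieceIndex (k m i : ℕ) : ℕ := min (i / m) (k - 1)

/-- The dyadic level of an index inside its piece. -/
def pieceLevel (k m i : ℕ) : ℕ := Nat.log 2 (i - m * pieceIndex k m i + 1)

theorem pieceIndex_mono (k m : ℕ) : Monotone (pieceIndex k m) := fun _ _ h =>
  min_le_min (Nat.div_le_div_right h) le_rfl

theorem pieceIndex_lt {k : ℕ} (hk : 1 ≤ k) (m i : ℕ) : pieceIndex k m i < k :=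
  (min_le_right _ _).trans_lt (by omega)

theorem pieceLevel_le {k m i i' : ℕ} (h : i ≤ i') (hp : pieceIndex k m i = pieceIndex k m i') :
    pieceLevel k m i ≤ pieceLevel k m i' := by
  unfold pieceLevel
  rw [hp]
  exact Nat.log_mono_right (by omega)

theorem pieceIndex_eq {k m i j : ℕ} (hj : j < k) (h1 : m * j ≤ i) (h2 : i < m * (j + 1)) :
    pieceIndex k m i = j := by
  have : i / m = j := Nat.div_eq_of_lt_le (by linarith) (by linarith)
  rw [pieceIndex, this]
  omega

theorem mul_pieceIndex_le (k m i : ℕ) : m * pieceIndex k m i ≤ i :=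
  (Nat.mul_le_mul_left m (min_le_left _ _)).trans (Nat.mul_div_le i m)

/-- Level `l` holds the offsets from `2 ^ l - 1` to `2 ^ (l + 1) - 2`, which fit in a piece of
length `m` because `2 ^ (l + 1) ≤ m + 1`. -/
theorem card_levelBlock_pieceLevel {n k m j l : ℕ} (hn : m * k ≤ n) (hj : j < k)
    (hl : l < Nat.log 2 (m + 1)) :
    (levelBlock (fun i : Fin n => pieceIndex k m i) (fun i : Fin n => pieceLevel k m i)
      j l).card = 2 ^ l := by
  have hm : 2 ^ (l + 1) ≤ m + 1 := Nat.pow_le_of_le_log (by omega) hl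
  have hjk : m * (j + 1) ≤ n := (Nat.mul_le_mul_left m hj).trans hn
  rw [mul_add, mul_one] at hjk
  have hpos : 0 < 2 ^ l := by positivity
  rw [pow_succ] at hm
  have hS : (levelBlock (fun i : Fin n => pieceIndex k m i) (fun i : Fin n => pieceLevel k m i)
      j l).map Fin.valEmbedding = Finset.Ico (m * j + 2 ^ l - 1) (m * j + 2 ^ l - 1 + 2 ^ l) := by
    ext i
    simp only [levelBlock, Finset.mem_map, Finset.mem_filter, Finset.mem_univ, true_and,
      Fin.valEmbedding_apply, Finset.mem_Ico]
    constructor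
    · rintro ⟨i, ⟨h1, h2⟩, rfl⟩
      have h3 := mul_pieceIndex_le k m i
      rw [pieceLevel, Nat.log_eq_iff (by right; omega)] at h2
      rw [h1, pow_succ] at *
      omega
    · rintro ⟨h1, h2⟩
      have hp : pieceIndex k m i = j := pieceIndex_eq hj (by omega) (by rw [mul_add]; omega)
      refine ⟨⟨i, by omega⟩, ⟨hp, ?_⟩, rfl⟩
      simp only [pieceLevel, hp]
      rw [Nat.log_eq_iff (by right; omega), pow_succ]
      omega
  rw [← Finset.card_map Fin.valEmbedding, hS]
  simp

theorem mem_isotonicPieces_of_pieceIndex {n k m : ℕ} (hk : 1 ≤ k) (hm : 1 ≤ m) (hn : m * k ≤ n) {G : ℝ}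
    (hG : 0 ≤ G) (θ : EuclideanSpace ℝ (Fin n)) (hθ : ∀ i, θ i = G * pieceIndex k m i) :
    θ ∈ isotonicPieces n k := by
  refine ⟨fun j => if (j : ℕ) = k then n else m * j, fun j => G * (j : ℕ), ?_, ?_, ?_, ?_, ?_⟩
  · have : ¬ 0 = k := by omega
    simp [this]
  · intro a b hab
    have hab' : (a : ℕ) ≤ b := hab
    have hb := b.is_le
    have h1 : m * (a : ℕ) ≤ m * b := Nat.mul_le_mul_left m hab'
    have h2 : m * (a : ℕ) ≤ m * k := Nat.mul_le_mul_left m a.is_le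
    simp only
    split_ifs <;> omega
  · simp
  · intro a b hab
    exact mul_le_mul_of_nonneg_left (by exact_mod_cast hab) hG
  · intro j i h1 h2
    have hj := j.is_lt
    have hjk : ¬ (j : ℕ) = k := by omega
    simp only [Fin.val_castSucc, hjk, if_false, Fin.val_succ] at h1 h2
    rw [hθ]
    congr 2
    -- The last piece absorbs the remainder of `n`, where the `min` in `pieceIndex` takes effect.
    by_cases h : (j : ℕ) + 1 = k
    · have : (j : ℕ) ≤ i / m := by
        rw [Nat.le_div_iff_mul_le hm, mul_comm]
        omega
      unfold pieceIndex
      omega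
    · rw [if_neg h] at h2
      exact pieceIndex_eq hj (by omega) (by omega)

end Levels

/-! ### Gaussian expectations and the risk. -/

section Gaussian

open Filter Topology

open scoped MatrixOrder in
theorem multivariateGaussian_sq_smul_one {ι : Type*} [Fintype ι] [DecidableEq ι]
    (θ : EuclideanSpace ℝ ι) {σ : ℝ} (hσ : 0 ≤ σ) :
    multivariateGaussian θ (σ ^ 2 • (1 : Matrix ι ι ℝ)) =
      (stdGaussian (EuclideanSpace ℝ ι)).map fun z => θ + σ • z := by
  have h : CFC.sqrt (σ ^ 2 • (1 : Matrix ι ι ℝ)) = σ • 1 :=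
    CFC.sqrt_unique (by simp [sq, smul_smul])
      (Matrix.PosSemidef.one.smul hσ).nonneg
  rw [multivariateGaussian, h]
  simp

/-- The mean absolute value of a standard normal variable. -/
noncomputable def gaussianMeanAbs : ℝ := ∫ x, |x| ∂gaussianReal 0 1

theorem integrable_abs_gaussianReal (μ : ℝ) (v : NNReal) :
    Integrable (fun x => |x|) (gaussianReal μ v) :=
  (IsGaussian.integrable_fun_id (μ := gaussianReal μ v)).abs

theorem gaussianMeanAbs_pos : 0 < gaussianMeanAbs := by
  rw [gaussianMeanAbs, integral_pos_iff_support_of_nonneg (fun _ => abs_nonneg _)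
    (integrable_abs_gaussianReal 0 1)]
  have : Function.support (fun x : ℝ => |x|) = {0}ᶜ := by
    ext x
    simp
  have := nullSingletonClass_gaussianReal (μ := 0) (v := 1) one_ne_zero
  rw [‹Function.support _ = _›, prob_compl_eq_one_sub (measurableSet_singleton 0)]
  simp

theorem integral_abs_gaussianReal {s : ℝ} (hs : 0 ≤ s) :
    ∫ x, |x| ∂gaussianReal 0 (s ^ 2).toNNReal = s * gaussianMeanAbs := by
  have h : gaussianReal 0 (s ^ 2).toNNReal = (gaussianReal 0 1).map (s * ·) := by
    rw [gaussianReal_map_const_mul]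
    congr 1
    · simp
    · ext
      simp [sq_nonneg]
  rw [h, integral_map (by fun_prop) (by fun_prop), gaussianMeanAbs, ← integral_const_mul]
  simp [abs_mul, abs_of_nonneg hs]

variable {n : ℕ} (p q : Fin n → ℕ)

/-- A block sum is the inner product with the block's indicator, whose squared norm is the block
size. -/
theorem map_blockSum_stdGaussian (j l : ℕ) :
    (stdGaussian (EuclideanSpace ℝ (Fin n))).map (blockSum p q j l) =
      gaussianReal 0 (√((levelBlock p q j l).card : ℝ) ^ 2).toNNReal := by
  set w : EuclideanSpace ℝ (Fin n) :=
    WithLp.toLp 2 fun i => if i ∈ levelBlock p q j l then 1 else 0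
  have hw : blockSum p q j l = innerSL ℝ w := by
    ext z
    simp [blockSum, w, PiLp.inner_apply]
  have hn : ‖w‖ ^ 2 = (levelBlock p q j l).card := by
    rw [EuclideanSpace.real_norm_sq_eq]
    simp [w]
  rw [hw, IsGaussian.map_eq_gaussianReal, integral_strongDual_stdGaussian,
    variance_dual_stdGaussian, innerSL_apply_norm, hn, Real.sq_sqrt (by positivity)]

theorem continuous_blockSum (j l : ℕ) : Continuous (blockSum p q j l) := by
  unfold blockSum
  fun_prop

theorem integrable_blockSum (j l : ℕ) :
    Integrable (blockSum p q j l) (stdGaussian (EuclideanSpace ℝ (Fin n))) := by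
  have h : Integrable (fun x => x) ((stdGaussian _).map (blockSum p q j l)) := by
    rw [map_blockSum_stdGaussian]
    exact IsGaussian.integrable_fun_id
  exact h.comp_measurable (continuous_blockSum p q j l).measurable

theorem integral_blockSum (j l : ℕ) :
    ∫ z, blockSum p q j l z ∂stdGaussian (EuclideanSpace ℝ (Fin n)) = 0 := by
  rw [← integral_map (f := fun x => x) (continuous_blockSum p q j l).aemeasurable (by fun_prop),
    map_blockSum_stdGaussian]
  simp

theorem integral_abs_blockSum (j l : ℕ) :
    ∫ z, |blockSum p q j l z| ∂stdGaussian (EuclideanSpace ℝ (Fin n)) =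
      √((levelBlock p q j l).card : ℝ) * gaussianMeanAbs := by
  rw [← integral_map (f := fun x => |x|) (continuous_blockSum p q j l).aemeasurable
    (by fun_prop), map_blockSum_stdGaussian, integral_abs_gaussianReal (by positivity)]

theorem integrable_blockGain (k L : ℕ) (t : ℝ) :
    Integrable (blockGain p q k L t) (stdGaussian (EuclideanSpace ℝ (Fin n))) := by
  unfold blockGain
  refine integrable_finsetSum _ fun b _ => ?_
  have h := integrable_blockSum p q b.1 b.2
  exact ((h.abs.sub (h.const_mul 6)).const_mul _).sub (integrable_const _)

theorem integral_blockGain {k L : ℕ} (t : ℝ)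
    (hcard : ∀ j < k, ∀ l < L, (levelBlock p q j l).card = 2 ^ l) :
    ∫ z, blockGain p q k L t z ∂stdGaussian (EuclideanSpace ℝ (Fin n)) =
      k * L * (2 * t * gaussianMeanAbs - 49 * t ^ 2) := by
  have hi := fun b : ℕ × ℕ => integrable_blockSum p q b.1 b.2
  have hd : ∀ b : ℕ × ℕ, Integrable
      (fun z => |blockSum p q b.1 b.2 z| - 6 * blockSum p q b.1 b.2 z)
      (stdGaussian (EuclideanSpace ℝ (Fin n))) :=
    fun b => (hi b).abs.sub ((hi b).const_mul 6)
  unfold blockGain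
  rw [integral_finsetSum]
  swap
  · exact fun b _ => ((hd b).const_mul _).sub (integrable_const _)
  have : ∀ b ∈ Finset.range k ×ˢ Finset.range L,
      ∫ z, (2 * (t / √(2 ^ b.2)) * (|blockSum p q b.1 b.2 z| - 6 * blockSum p q b.1 b.2 z)
        - 49 * t ^ 2) ∂stdGaussian (EuclideanSpace ℝ (Fin n)) =
      2 * t * gaussianMeanAbs - 49 * t ^ 2 := by
    intro b hb
    simp only [Finset.mem_product, Finset.mem_range] at hb
    rw [integral_sub ((hd b).const_mul _) (integrable_const _),
      integral_const_mul, integral_sub (hi b).abs ((hi b).const_mul 6), integral_const_mul,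
      integral_blockSum, integral_abs_blockSum, hcard _ hb.1 _ hb.2]
    have : √((2 : ℝ) ^ b.2) ≠ 0 := by positivity
    simp only [integral_const, probReal_univ, Nat.cast_pow, Nat.cast_ofNat, smul_eq_mul]
    field_simp
    ring
  rw [Finset.sum_congr rfl this, Finset.sum_const, Finset.card_product, Finset.card_range,
    Finset.card_range, nsmul_eq_mul, Nat.cast_mul]

theorem ofReal_integral_le_lintegral_ofReal {α : Type*} [MeasurableSpace α] {μ : Measure α}
    {f : α → ℝ} (hf : Integrable f μ) :
    ENNReal.ofReal (∫ x, f x ∂μ) ≤ ∫⁻ x, ENNReal.ofReal (f x) ∂μ := by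
  rw [integral_eq_lintegral_pos_part_sub_lintegral_neg_part hf]
  exact (ENNReal.ofReal_le_ofReal (sub_le_self _ ENNReal.toReal_nonneg)).trans
    ENNReal.ofReal_toReal_le

/-- A loss bound on a ball of noise vectors turns into a risk bound. -/
theorem ofReal_setIntegral_le_isotonicRisk {σ : ℝ} (hσ : 0 ≤ σ) (θ : EuclideanSpace ℝ (Fin n))
    {F : EuclideanSpace ℝ (Fin n) → ℝ}
    (hFi : Integrable F (stdGaussian (EuclideanSpace ℝ (Fin n)))) {R : ℝ}
    (h : ∀ z, ‖z‖ ≤ R → σ ^ 2 * F z ≤ ‖isotonicLSE n (θ + σ • z) - θ‖ ^ 2) :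
    ENNReal.ofReal (σ ^ 2 * ∫ z in Metric.closedBall 0 R, F z
      ∂stdGaussian (EuclideanSpace ℝ (Fin n))) ≤ isotonicRisk n σ θ := by
  rcases hσ.eq_or_lt with rfl | hσ'
  · simp
  have hB : MeasurableSet (Metric.closedBall (0 : EuclideanSpace ℝ (Fin n)) R) :=
    Metric.isClosed_closedBall.measurableSet
  -- An affine homeomorphism permits the change of variables without measurability of the estimator.
  let e : EuclideanSpace ℝ (Fin n) ≃ₜ EuclideanSpace ℝ (Fin n) :=
    (Homeomorph.smulOfNeZero σ hσ'.ne').trans (Homeomorph.addLeft θ)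
  have he : MeasurableEmbedding fun z : EuclideanSpace ℝ (Fin n) => θ + σ • z :=
    e.measurableEmbedding
  rw [isotonicRisk, multivariateGaussian_sq_smul_one θ hσ, he.lintegral_map,
    ← integral_const_mul]
  refine (ofReal_integral_le_lintegral_ofReal (hFi.restrict.const_mul _)).trans ?_
  refine le_trans ?_ (setLIntegral_le_lintegral (Metric.closedBall 0 R) _)
  refine setLIntegral_mono' hB fun z hz => ENNReal.ofReal_le_ofReal (h z ?_)
  simpa using hz

end Gaussian

/-! ### Counting levels and the final bound. -/

theorem log_exp_one_mul_div_le {n k : ℕ} (hk : 1 ≤ k) (hn : k ≤ n) :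
    Real.log (Real.exp 1 * n / k) ≤ 3 * Nat.log 2 (n / k + 1) := by
  have hk' : (0 : ℝ) < k := by exact_mod_cast hk
  have hn' : (0 : ℝ) < n := by exact_mod_cast hk.trans hn
  set L := Nat.log 2 (n / k + 1)
  have hL : 1 ≤ L := Nat.log_pos (by norm_num) (by have := Nat.div_pos hn hk; omega)
  have h1 : (n : ℝ) / k ≤ 2 ^ (L + 1) := by
    rw [div_le_iff₀ hk']
    have h2 : n / k + 1 < 2 ^ (L + 1) := Nat.lt_pow_succ_log_self (by norm_num) _
    have h3 : n < (n / k + 1) * k := by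
      have := Nat.lt_div_mul_add (a := n) hk
      linarith
    exact_mod_cast h3.le.trans (Nat.mul_le_mul_right k h2.le)
  have h4 : Real.log ((n : ℝ) / k) ≤ (L + 1) * Real.log 2 := by
    have := Real.log_le_log (by positivity) h1
    rwa [Real.log_pow, Nat.cast_add, Nat.cast_one] at this
  rw [mul_div_assoc, Real.log_mul (Real.exp_ne_zero 1) (by positivity), Real.log_exp]
  have hL' : (1 : ℝ) ≤ L := by exact_mod_cast hL
  -- Since `L ≥ 1`, `1 + (L + 1) log 2 ≤ (1 + 2 log 2) L ≤ 3 L`.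
  nlinarith [Real.log_two_lt_d9]

theorem proposition2p1 :
    ∃ c : ℝ, 0 < c ∧ ∀ (n k : ℕ) (σ : ℝ), 1 ≤ k → k ≤ n → 0 < σ →
      ENNReal.ofReal (c * σ ^ 2 * (k : ℝ) * Real.log (Real.exp 1 * (n : ℝ) / (k : ℝ))) ≤
        ⨆ θ ∈ isotonicPieces n k, isotonicRisk n σ θ := by
  have hκ := gaussianMeanAbs_pos
  -- `294 = 3 * 2 * 49`: 3 from the level count, 2 from truncation, 49 from the optimal gain per
  -- block.
  refine ⟨gaussianMeanAbs ^ 2 / 294, by positivity, fun n k σ hk hn hσ => ?_⟩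
  set m := n / k with hm
  set L := Nat.log 2 (m + 1) with hL
  -- The maximizer of `2 * t * gaussianMeanAbs - 49 * t ^ 2`.
  set t := gaussianMeanAbs / 49 with ht
  set p := fun i : Fin n => pieceIndex k m i with hp
  set q := fun i : Fin n => pieceLevel k m i with hq
  have hm1 : 1 ≤ m := Nat.div_pos hn hk
  have hLpos : 0 < L := Nat.log_pos (by norm_num) (by omega)
  have hmk : m * k ≤ n := Nat.div_mul_le_self n k
  have hcard : ∀ j < k, ∀ l < L, (levelBlock p q j l).card = 2 ^ l := fun j hj l hl =>
    card_levelBlock_pieceLevel hmk hj hl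
  have hint := integral_blockGain p q t hcard
  have hkL : (0 : ℝ) < k * L := by positivity
  have hlt : k * L * (gaussianMeanAbs ^ 2 / 98) <
      ∫ z, blockGain p q k L t z ∂stdGaussian (EuclideanSpace ℝ (Fin n)) := by
    rw [hint]
    refine mul_lt_mul_of_pos_left ?_ hkL
    rw [ht]
    nlinarith [sq_pos_of_pos hκ]
  -- A ball retaining more than half of the expected gain; its radius then fixes the jump `G`.
  obtain ⟨R, hR⟩ := (((aecover_closedBall (x := (0 : EuclideanSpace ℝ (Fin n)))
    (μ := stdGaussian (EuclideanSpace ℝ (Fin n))) Filter.tendsto_id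
    ).integral_tendsto_of_countably_generated
      (integrable_blockGain p q k L t)).eventually_const_lt hlt).and
    (Filter.eventually_ge_atTop 0) |>.exists
  have ht0 : 0 ≤ t := by positivity
  set G := 2 * (σ * R) + 7 * (σ * t) with hG
  have hG0 : 0 ≤ G := by
    have := hR.2
    positivity
  let θ : EuclideanSpace ℝ (Fin n) := WithLp.toLp 2 fun i => G * p i
  refine le_trans ?_ (le_iSup₂ (f := fun θ _ => isotonicRisk n σ θ) θ
    (mem_isotonicPieces_of_pieceIndex hk hm1 hmk hG0 θ fun _ => rfl))
  refine le_trans ?_ (ofReal_setIntegral_le_isotonicRisk hσ.le θ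
    (integrable_blockGain p q k L t) (R := R) fun z hz => ?_)
  · refine ENNReal.ofReal_le_ofReal ?_
    have h1 := log_exp_one_mul_div_le hk hn
    have h2 := hR.1.le
    simp only [id] at h2
    calc gaussianMeanAbs ^ 2 / 294 * σ ^ 2 * k * Real.log (Real.exp 1 * n / k)
        ≤ gaussianMeanAbs ^ 2 / 294 * σ ^ 2 * k * (3 * L) :=
          mul_le_mul_of_nonneg_left h1 (by positivity)
      _ = σ ^ 2 * (k * L * (gaussianMeanAbs ^ 2 / 98)) := by ring
      _ ≤ _ := mul_le_mul_of_nonneg_left h2 (sq_nonneg σ)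
  · refine blockGain_le_norm_isotonicLSE_sub_sq ht0 hσ.le hG0 (fun i => pieceIndex_lt hk m i)
      (fun _ _ h => pieceIndex_mono k m h) (fun _ _ h h' => pieceLevel_le h h') hcard θ z
      (fun _ => rfl) ?_
    rw [hG]
    gcongr
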